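/- All automata read infinite words over a finite alphabet $\Sigma$, have finitely many states, an initial state $q_{\mathrm{init}}$, a set of transitions $\Delta\subseteq Q\times\Sigma\times Q$, and acceptance on transitions. A \emph{generalised Büchi automaton} with $k$ colours labels every transition with a subset of a $k$-element set $C$; a run (an infinite path from $q_{\mathrm{init}}$ labelled by the input word) is accepting if every colour of $C$ is seen infinitely often, and the language $L(\mathcal A)$ is the set of words with an accepting run. Automata are equivalent if they have the same language. $\mathcal A$ is \emph{deterministic} if for every $(p,a)\in Q\times\Sigma$ there is at most one $q$ with $(p,a,q)\in\Delta$. $\mathcal A$ is \emph{history-deterministic} (HD) if it has a resolver: a function $\sigma:\Sigma^+\to\Delta$ such that for every $w=a_0a_1\cdots\in\Sigma^\omega$ the sequence $\sigma(a_0)\,\sigma(a_0a_1)\,\sigma(a_0a_1a_2)\cdots$ is a run on $w$, and it is accepting whenever $w\in L(\mathcal A)$. There is an absolute constant $K$ such that the following two statements hold. 1. Let $\mathcal A$ be a deterministic generalised Büchi automaton with $n$ states and $k$ colours. Then there is a deterministic generalised Büchi automaton that is equivalent to $\mathcal A$, has the minimal number of states among all deterministic generalised Büchi automata equivalent to $\mathcal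 A$, and uses at most $K n^2k$ colours. 2. Let $\mathcal A$ be an HD generalised Büchi automaton with $n$ states and $k$ colours. Then there is an HD generalised Büchi automaton that is equivalent to $\mathcal A$, has the minimal number of states among all HD generalised Büchi automata equivalent to $\mathcal A$, and uses at most $K n^3k^2$ colours. -/

import Mathlib

/-- The set of letters that occur infinitely often in an infinite word. -/
def infOften {Γ : Type*} (w : ℕ → Γ) : Set Γ :=
  {x | ∃ᶠ i in Filter.atTop, w i = x}

/-- The generalised Büchi condition with set of colours `C`, over the output alphabet `Set C`:
every colour belongs to some set of colours that occurs infinitely often. -/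
def genBuchi (C : Type*) : Set (ℕ → Set C) :=
  {w | ⋃₀ infOften w = Set.univ}

/-- A (nondeterministic, possibly incomplete) automaton on infinite words, with input alphabet `S`,
states `Q`, output alphabet `Γ`, and with labels and acceptance on transitions. -/
structure OmegaAut (S Q Γ : Type*) where
  init : Q
  trans : Set (Q × S × Q)
  col : trans → Γ
  acc : Set (ℕ → Γ)

namespace OmegaAut

variable {S Q Γ : Type*}

/-- `ρ` is a run of `A` on the infinite word `w`. -/
def IsRunOn (A : OmegaAut S Q Γ) (ρ : ℕ → A.trans) (w : ℕ → S) : Prop :=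
  (ρ 0).1.1 = A.init ∧ ∀ i, (ρ i).1.2.1 = w i ∧ (ρ i).1.2.2 = (ρ (i + 1)).1.1

/-- The output of `ρ` satisfies the acceptance condition. -/
def IsAccepting (A : OmegaAut S Q Γ) (ρ : ℕ → A.trans) : Prop :=
  (fun i => A.col (ρ i)) ∈ A.acc

/-- The set of infinite words that admit an accepting run. -/
def lang (A : OmegaAut S Q Γ) : Set (ℕ → S) :=
  {w | ∃ ρ : ℕ → A.trans, A.IsRunOn ρ w ∧ A.IsAccepting ρ}

/-- For every state and letter there is at most one transition. -/
def IsDet (A : OmegaAut S Q Γ) : Prop :=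
  ∀ p a q q', (p, a, q) ∈ A.trans → (p, a, q') ∈ A.trans → q = q'

/-- The nonempty finite prefix `w 0, …, w i` of the infinite word `w`. -/
def pre (w : ℕ → S) (i : ℕ) : {u : List S // u ≠ []} :=
  ⟨(List.range (i + 1)).map w, by simp⟩

/-- The sequence of transitions that `σ` chooses along `w`. -/
def inducedRun (A : OmegaAut S Q Γ) (σ : {u : List S // u ≠ []} → A.trans) (w : ℕ → S) :
    ℕ → A.trans :=
  fun i => σ (pre w i)

/-- `σ` is a resolver: along every word it builds a run, which is accepting if the word is in the
language. -/
def IsResolver (A : OmegaAut S Q Γ) (σ : {u : List S // u ≠ []} → A.trans) : Prop :=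
  ∀ w : ℕ → S, A.IsRunOn (A.inducedRun σ w) w ∧
    (w ∈ A.lang → A.IsAccepting (A.inducedRun σ w))

/-- `A` is history-deterministic. -/
def IsHD (A : OmegaAut S Q Γ) : Prop :=
  ∃ σ, A.IsResolver σ

/-- `A` is a generalised Büchi automaton with set of colours `C`. -/
def IsGenBuchi {C : Type*} (A : OmegaAut S Q (Set C)) : Prop :=
  A.acc = genBuchi C

/-- `A` is a deterministic generalised Büchi automaton with the least number of states among the
equivalent deterministic generalised Büchi automata. -/
def IsMinimalDetGenBuchi {C : Type*} (A : OmegaAut S Q (Set C)) : Prop :=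
  A.IsGenBuchi ∧ A.IsDet ∧
    ∀ (Q' C' : Type) [Finite Q'] [Finite C'] (B : OmegaAut S Q' (Set C')),
      B.IsGenBuchi → B.IsDet → B.lang = A.lang → Nat.card Q ≤ Nat.card Q'

/-- `A` is a history-deterministic generalised Büchi automaton with the least number of states among
the equivalent history-deterministic generalised Büchi automata. -/
def IsMinimalHDGenBuchi {C : Type*} (A : OmegaAut S Q (Set C)) : Prop :=
  A.IsGenBuchi ∧ A.IsHD ∧
    ∀ (Q' C' : Type) [Finite Q'] [Finite C'] (B : OmegaAut S Q' (Set C')),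
      B.IsGenBuchi → B.IsHD → B.lang = A.lang → Nat.card Q ≤ Nat.card Q'

end OmegaAut

/-! Let L be the language. Suppose a finite graph E witnesses the complement of L: every word
outside L has a suffix labelling a path of E from a vertex ν, and no path of E from ν completes the
prefix already read to a word of L. Then any automaton for L with m states can drop all but m·|E| of
its colours, where |E| counts vertices (`exists_few_colours`). At each vertex x of the product with
E, if some colour lies on no closed walk through x, keep one such colour. If a word outside L
satisfied the kept colours, its product path would visit some x infinitely often. A colour kept for
x would then lie on a closed walk through x, which is impossible. If none was kept, some closed walk
through x sees all colours, and repeating it forever gives a word accepted by the automaton and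
refuted by E.

This is applied to an automaton with the fewest states, however many colours it has, while E comes
from the given automaton with n states and k colours.

In the deterministic case E has one copy of the automaton per colour, with that colour forbidden: nk
vertices.

In the history-deterministic case, degeneralising along a resolver gives a Büchi automaton with at
most nk states. Its transitions are changed until from every state some strategy sees acceptance no
later than any path from some state with the same residual
(`IsResolving.exists_coverStates_eq_univ`). The edges that lose no future acceptance then form E
(`IsResolving.exists_refutes`).

Both cases give n²k with constant 1, which is sharper than required in the second. -/

open Filter

/-! ### Finite and infinite words -/

namespace OmegaWord

variable {S : Type*}

/-- Prepend a letter to an infinite word. -/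
def scons (a : S) (y : ℕ → S) : ℕ → S
  | 0 => a
  | n + 1 => y n

/-- Prepend a finite word to an infinite word. -/
def lapp : List S → (ℕ → S) → ℕ → S
  | [], y => y
  | a :: u, y => scons a (lapp u y)

/-- The suffix of `w` from position `t` on. -/
def drop (w : ℕ → S) (t : ℕ) : ℕ → S := fun i => w (t + i)

/-- The prefix of `w` of length `t`. -/
def take (w : ℕ → S) (t : ℕ) : List S := (List.range t).map w

theorem take_succ (w : ℕ → S) (t : ℕ) : take w (t + 1) = take w t ++ [w t] := by
  simp [take, List.range_succ]

theorem take_succ_cons (w : ℕ → S) (t : ℕ) : take w (t + 1) = w 0 :: take (drop w 1) t := by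
  simp [take, List.range_succ_eq_map, drop, Function.comp_def, add_comm]

theorem drop_drop (w : ℕ → S) (s t : ℕ) : drop (drop w s) t = drop w (s + t) := by
  funext i; simp [drop, add_assoc]

theorem take_add (w : ℕ → S) (s t : ℕ) : take w (s + t) = take w s ++ take (drop w s) t := by
  induction t with
  | zero => simp [take]
  | succ t ih => rw [← add_assoc, take_succ, ih, take_succ, List.append_assoc]; rfl

theorem lapp_append (u v : List S) (y : ℕ → S) : lapp (u ++ v) y = lapp u (lapp v y) := by
  induction u with
  | nil => rfl
  | cons a u ih => simp [lapp, ih]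

theorem drop_lapp (u : List S) (y : ℕ → S) : drop (lapp u y) u.length = y := by
  induction u with
  | nil => funext i; simp [drop, lapp]
  | cons a u ih =>
    funext i
    rw [← congrFun ih i]
    simp only [drop, lapp, List.length_cons]
    rw [show u.length + 1 + i = (u.length + i) + 1 by omega]
    rfl

theorem take_lapp (u : List S) (y : ℕ → S) : take (lapp u y) u.length = u := by
  induction u with
  | nil => rfl
  | cons a u ih =>
    rw [List.length_cons, take_succ_cons]
    have : drop (lapp (a :: u) y) 1 = lapp u y := by
      funext i; simp [drop, lapp, add_comm 1 i, scons]
    rw [this, ih]; rfl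

theorem frequently_add {p : ℕ → Prop} (k : ℕ) :
    (∃ᶠ i in atTop, p (k + i)) ↔ ∃ᶠ i in atTop, p i := by
  simp only [frequently_atTop]
  constructor
  · intro h N
    obtain ⟨i, hi, hp⟩ := h N
    exact ⟨k + i, by omega, hp⟩
  · intro h N
    obtain ⟨i, hi, hp⟩ := h (k + N)
    exact ⟨i - k, by omega, by rwa [Nat.add_sub_cancel' (by omega)]⟩

end OmegaWord

/-! ### Paths and walks in labelled graphs -/

open OmegaWord

/-- The states `r` and the letters `w` form an infinite path of the labelled graph `T`. -/
def IsPath {S Q : Type*} (T : Set (Q × S × Q)) (r : ℕ → Q) (w : ℕ → S) : Prop :=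
  ∀ i, (r i, w i, r (i + 1)) ∈ T

/-- The infinite words read from `q` along paths that use every set `F c` infinitely often. -/
def recLang {S Q C : Type*} (T : Set (Q × S × Q)) (F : C → Set (Q × S × Q)) (q : Q) :
    Set (ℕ → S) :=
  {w | ∃ r, r 0 = q ∧ IsPath T r w ∧ ∀ c, ∃ᶠ i in atTop, (r i, w i, r (i + 1)) ∈ F c}

/-- The finite word leads from `q` to `q'` in the labelled graph `T`. -/
def Steps {S Q : Type*} (T : Set (Q × S × Q)) : Q → List S → Q → Prop
  | q, [], q' => q = q'
  | q, a :: u, q' => ∃ p, (q, a, p) ∈ T ∧ Steps T p u q'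

section Graph

variable {S Q C : Type*} {T : Set (Q × S × Q)} {F : C → Set (Q × S × Q)}

theorem IsPath.drop {r : ℕ → Q} {w : ℕ → S} (h : IsPath T r w) (t : ℕ) :
    IsPath T (OmegaWord.drop r t) (OmegaWord.drop w t) := fun i => h (t + i)

theorem IsPath.drop_mem_recLang {r : ℕ → Q} {w : ℕ → S} (h : IsPath T r w)
    (hF : ∀ c, ∃ᶠ i in atTop, (r i, w i, r (i + 1)) ∈ F c) (t : ℕ) :
    OmegaWord.drop w t ∈ recLang T F (r t) :=
  ⟨OmegaWord.drop r t, rfl, h.drop t, fun c =>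
    (frequently_add (p := fun i => (r i, w i, r (i + 1)) ∈ F c) t).2 (hF c)⟩

theorem Steps.append {q p q' : Q} {u v : List S} (h : Steps T q u p) (h' : Steps T p v q') :
    Steps T q (u ++ v) q' := by
  induction u generalizing q with
  | nil => cases h; exact h'
  | cons a u ih => obtain ⟨x, hx, h⟩ := h; exact ⟨x, hx, ih h⟩

theorem Steps.of_append {q q' : Q} {u v : List S} (h : Steps T q (u ++ v) q') :
    ∃ p, Steps T q u p ∧ Steps T p v q' := by
  induction u generalizing q with
  | nil => exact ⟨q, rfl, h⟩
  | cons a u ih =>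
    obtain ⟨x, hx, h⟩ := h
    obtain ⟨p, h1, h2⟩ := ih h
    exact ⟨p, ⟨x, hx, h1⟩, h2⟩

theorem IsPath.steps_take {r : ℕ → Q} {w : ℕ → S} (h : IsPath T r w) (t : ℕ) :
    Steps T (r 0) (take w t) (r t) := by
  induction t with
  | zero => rfl
  | succ t ih => rw [take_succ]; exact ih.append ⟨_, h t, rfl⟩

theorem recLang_scons {q q' : Q} {a : S} {y : ℕ → S} (h : (q, a, q') ∈ T)
    (hy : y ∈ recLang T F q') : scons a y ∈ recLang T F q := by
  obtain ⟨r, rfl, hr, hF⟩ := hy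
  refine ⟨scons q r, rfl, ?_, fun c => ?_⟩
  · rintro (_ | i)
    exacts [h, hr i]
  · rw [← frequently_add 1]
    refine (hF c).mono fun i hi => ?_
    rw [add_comm 1 i]
    exact hi

theorem recLang_of_scons {q : Q} {a : S} {y : ℕ → S} (h : scons a y ∈ recLang T F q) :
    ∃ q', (q, a, q') ∈ T ∧ y ∈ recLang T F q' := by
  obtain ⟨r, rfl, hr, hF⟩ := h
  refine ⟨r 1, hr 0, ?_⟩
  have := hr.drop_mem_recLang hF 1
  rwa [show OmegaWord.drop (scons a y) 1 = y from drop_lapp [a] y] at this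

theorem recLang_lapp {q q' : Q} {u : List S} {y : ℕ → S} (h : Steps T q u q')
    (hy : y ∈ recLang T F q') : lapp u y ∈ recLang T F q := by
  induction u generalizing q with
  | nil => cases h; exact hy
  | cons a u ih => obtain ⟨p, hp, h⟩ := h; exact recLang_scons hp (ih h)

theorem recLang_of_lapp {q : Q} {u : List S} {y : ℕ → S} (h : lapp u y ∈ recLang T F q) :
    ∃ q', Steps T q u q' ∧ y ∈ recLang T F q' := by
  induction u generalizing q with
  | nil => exact ⟨q, rfl, h⟩
  | cons a u ih =>
    obtain ⟨p, hp, h⟩ := recLang_of_scons h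
    obtain ⟨q', h1, h2⟩ := ih h
    exact ⟨q', ⟨p, hp, h1⟩, h2⟩

/-- The list of edges is a walk from the first vertex to the second. -/
def IsWalk (G : Set (Q × S × Q)) : Q → List (Q × S × Q) → Q → Prop
  | x, [], y => x = y
  | x, e :: l, y => e ∈ G ∧ e.1 = x ∧ IsWalk G e.2.2 l y

theorem IsWalk.append {x y z : Q} {l l' : List (Q × S × Q)} (h : IsWalk T x l y)
    (h' : IsWalk T y l' z) : IsWalk T x (l ++ l') z := by
  induction l generalizing x with
  | nil => cases h; exact h'
  | cons e l ih => exact ⟨h.1, h.2.1, ih h.2.2⟩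

theorem IsPath.isWalk {r : ℕ → Q} {w : ℕ → S} (h : IsPath T r w) (s n : ℕ) :
    IsWalk T (r s) ((List.range n).map fun i => (r (s + i), w (s + i), r (s + i + 1)))
      (r (s + n)) := by
  induction n with
  | zero => rfl
  | succ n ih =>
    rw [List.range_succ, List.map_append]
    exact ih.append ⟨h _, rfl, rfl⟩

/-- Infinitely many nonempty walks that fit together form an infinite path. -/
theorem exists_path_of_walks {Z : Type*} (G : Set (Q × S × Q)) (vert : Z → Q) (nxt : Z → Z)
    (l : Z → List (Q × S × Q)) (hl : ∀ z, l z ≠ [])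
    (hw : ∀ z, IsWalk G (vert z) (l z) (vert (nxt z))) (z₀ : Z) :
    ∃ r w, IsPath G r w ∧ r 0 = vert z₀ ∧
      ∀ n, ∀ e ∈ l (nxt^[n] z₀), ∃ i ≥ n, (r i, w i, r (i + 1)) = e := by
  let start : Z → Z × (Q × S × Q) × List (Q × S × Q) :=
    fun z => (nxt z, (l z).head (hl z), (l z).tail)
  let step : Z × (Q × S × Q) × List (Q × S × Q) → Z × (Q × S × Q) × List (Q × S × Q) :=
    fun p => match p with
      | (z, _, []) => start z
      | (z, _, e :: k) => (z, e, k)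
  let Inv : Z × (Q × S × Q) × List (Q × S × Q) → Prop :=
    fun p => IsWalk G p.2.1.1 (p.2.1 :: p.2.2) (vert p.1)
  have hst : ∀ z, (start z).2.1.1 = vert z ∧ Inv (start z) := by
    intro z
    have h := hw z
    rw [← List.cons_head_tail (hl z)] at h
    exact ⟨h.2.1, h.1, rfl, h.2.2⟩
  have hstep : ∀ p, Inv p → p.2.1.2.2 = (step p).2.1.1 ∧ Inv (step p) := by
    rintro ⟨z, e, _ | ⟨e', k⟩⟩ h
    · exact ⟨h.2.2.trans (hst z).1.symm, (hst z).2⟩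
    · exact ⟨h.2.2.2.1.symm, h.2.2.1, rfl, h.2.2.2.2⟩
  let P : ℕ → Z × (Q × S × Q) × List (Q × S × Q) := fun i => step^[i] (start z₀)
  have hP : ∀ i, P (i + 1) = step (P i) := fun i => Function.iterate_succ_apply' _ _ _
  have hInv : ∀ i, Inv (P i) := by
    intro i
    induction i with
    | zero => exact (hst z₀).2
    | succ i ih => rw [hP]; exact (hstep _ ih).2
  have hedge : ∀ i, ((P i).2.1.1, (P i).2.1.2.1, (P (i + 1)).2.1.1) = (P i).2.1 := by
    intro i
    rw [hP, ← (hstep _ (hInv i)).1]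
  have hrun : ∀ k : List (Q × S × Q), ∀ i z e, P i = (z, e, k) →
      P (i + k.length + 1) = start z ∧ ∀ x ∈ e :: k, ∃ j ≥ i, (P j).2.1 = x := by
    intro k
    induction k with
    | nil =>
      intro i z e h
      refine ⟨by simp [hP, h, step], fun x hx => ⟨i, le_rfl, ?_⟩⟩
      rw [h]
      exact (List.mem_singleton.1 hx).symm
    | cons e' k ih =>
      intro i z e h
      obtain ⟨h1, h2⟩ := ih (i + 1) z e' (by rw [hP, h])
      refine ⟨by rw [← h1]; congr 1; simp; omega, fun x hx => ?_⟩
      rcases List.mem_cons.1 hx with rfl | hx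
      · exact ⟨i, le_rfl, by rw [h]⟩
      · obtain ⟨j, hj, hx⟩ := h2 x hx
        exact ⟨j, by omega, hx⟩
  have htime : ∀ n, ∃ i ≥ n, P i = start (nxt^[n] z₀) := by
    intro n
    induction n with
    | zero => exact ⟨0, le_rfl, rfl⟩
    | succ n ih =>
      obtain ⟨i, hi, h⟩ := ih
      have h' := (hrun _ i _ _ h).1
      rw [← Function.iterate_succ_apply' nxt] at h'
      exact ⟨_, by omega, h'⟩
  refine ⟨fun i => (P i).2.1.1, fun i => (P i).2.1.2.1, fun i => ?_, (hst z₀).1, ?_⟩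
  · simp only [hedge]
    exact (hInv i).1
  · intro n e he
    obtain ⟨i, hi, h⟩ := htime n
    obtain ⟨j, hj, h⟩ := (hrun _ i _ _ h).2 e (by rwa [List.cons_head_tail])
    exact ⟨j, by omega, (hedge j).trans h⟩

end Graph

/-! ### Dropping colours by means of a witness graph -/

section Recolour

variable {S Q C P : Type*}

/-- The infinite words that label a path of `E` starting in `ν`. -/
def pathLang (E : Set (P × S × P)) (ν : P) : Set (ℕ → S) :=
  recLang E (fun c : Empty => c.elim) ν

theorem mem_pathLang {E : Set (P × S × P)} {ν : P} {y : ℕ → S} :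
    y ∈ pathLang E ν ↔ ∃ π, π 0 = ν ∧ IsPath E π y := by
  simp [pathLang, recLang]

/-- After reading `x`, every word labelling a path of `E` from `ν` leads out of `L`. -/
def Refutes (E : Set (P × S × P)) (L : Set (ℕ → S)) (x : List S) (ν : P) : Prop :=
  ∀ y ∈ pathLang E ν, lapp x y ∉ L

theorem Refutes.append {E : Set (P × S × P)} {L : Set (ℕ → S)} {x u : List S} {ν ν' : P}
    (h : Refutes E L x ν) (hu : Steps E ν u ν') : Refutes E L (x ++ u) ν' := by
  intro y hy
  rw [lapp_append]
  exact h _ (recLang_lapp hu hy)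

/-- The product of two labelled graphs. -/
def prodGraph (T : Set (Q × S × Q)) (E : Set (P × S × P)) : Set ((Q × P) × S × (Q × P)) :=
  {e | (e.1.1, e.2.1, e.2.2.1) ∈ T ∧ (e.1.2, e.2.1, e.2.2.2) ∈ E}

/-- Closed walks through the same vertex can be concatenated. The hypothesis `h0` supplies a
nonempty walk even when `C` is empty. -/
theorem exists_closed_walk_through [Finite C] {V : Type*} {G : Set (V × S × V)}
    {M : C → Set (V × S × V)} {x : V}
    (h0 : ∃ l, l ≠ [] ∧ IsWalk G x l x) (h : ∀ c, ∃ l, IsWalk G x l x ∧ ∃ e ∈ l, e ∈ M c) :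
    ∃ l, l ≠ [] ∧ IsWalk G x l x ∧ ∀ c, ∃ e ∈ l, e ∈ M c := by
  classical
  have := Fintype.ofFinite C
  suffices H : ∀ s : Finset C, ∃ l, l ≠ [] ∧ IsWalk G x l x ∧ ∀ c ∈ s, ∃ e ∈ l, e ∈ M c by
    simpa using H Finset.univ
  intro s
  induction s using Finset.induction_on with
  | empty => simpa using h0
  | insert c s _ ih =>
    obtain ⟨l, hl, hw, hs⟩ := ih
    obtain ⟨k, hk, e, he, hc⟩ := h c
    refine ⟨l ++ k, by simp [hl], hw.append hk, ?_⟩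
    simp only [Finset.mem_insert, forall_eq_or_imp]
    refine ⟨⟨e, by simp [he], hc⟩, fun d hd => ?_⟩
    obtain ⟨f, hf, hfd⟩ := hs d hd
    exact ⟨f, by simp [hf], hfd⟩

/-- If the words outside the language are witnessed by the paths of a finite graph `E`, then few
of the acceptance sets are needed. -/
theorem exists_few_colours [Finite Q] [Finite C] [Finite P] {T : Set (Q × S × Q)}
    {F : C → Set (Q × S × Q)} {q₀ : Q} {E : Set (P × S × P)}
    (hE : ∀ w ∉ recLang T F q₀, w ∈ pathLang T q₀ →
      ∃ t ν, Refutes E (recLang T F q₀) (take w t) ν ∧ drop w t ∈ pathLang E ν) :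
    ∃ J : Set C, Nat.card J ≤ Nat.card Q * Nat.card P ∧
      recLang T (fun c : J => F c) q₀ = recLang T F q₀ := by
  classical
  -- The kept colours are the values of `φ`, at most one per product vertex.
  let Avoid : Q × P → C → Prop := fun x c => ∀ l, IsWalk (prodGraph T E) x l x →
    ∀ e ∈ l, (e.1.1, e.2.1, e.2.2.1) ∉ F c
  let φ : {x // ∃ c, Avoid x c} → C := fun x => x.2.choose
  have hφ : ∀ x, Avoid x.1 (φ x) := fun x => x.2.choose_spec
  refine ⟨Set.range φ, ?_, ?_⟩
  · rw [← Nat.card_prod]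
    exact (Nat.card_le_card_of_surjective _ Set.rangeFactorization_surjective).trans
      (Finite.card_subtype_le _)
  refine Set.Subset.antisymm (fun w hw => ?_) (fun w ⟨r, h0, hr, hF⟩ => ⟨r, h0, hr, fun c => hF c⟩)
  by_contra hL
  obtain ⟨r, rfl, hr, hF⟩ := hw
  obtain ⟨t, ν, hν, hν2⟩ := hE w hL (mem_pathLang.2 ⟨r, rfl, hr⟩)
  obtain ⟨π, rfl, hπ⟩ := mem_pathLang.1 hν2
  let v : ℕ → Q × P := fun i => (r (t + i), π i)
  have hv : IsPath (prodGraph T E) v (drop w t) := fun i => ⟨hr (t + i), hπ i⟩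
  obtain ⟨x, hx⟩ : ∃ x, ∃ᶠ i in atTop, v i = x := by
    by_contra! hcon
    have : ∀ᶠ i in atTop, ∀ x, v i ≠ x := by
      rw [Filter.eventually_all]
      exact fun x => by simpa using hcon x
    obtain ⟨i, hi⟩ := this.exists
    exact hi _ rfl
  by_cases hA : ∃ c, Avoid x c
  -- The kept colour recurs along the path, so it occurs between two visits to `x`, on a closed
  -- walk.
  · have hf := (frequently_add t).2 (hF ⟨φ ⟨x, hA⟩, ⟨x, hA⟩, rfl⟩)
    obtain ⟨i, -, hi⟩ := frequently_atTop.1 hx 0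
    obtain ⟨j, hj, hc⟩ := frequently_atTop.1 hf i
    obtain ⟨k, hk, hkx⟩ := frequently_atTop.1 hx (j + 1)
    have hwalk := hv.isWalk i (k - i)
    rw [show i + (k - i) = k by omega, hi, hkx] at hwalk
    refine hφ ⟨x, hA⟩ _ hwalk _ (List.mem_map.2 ⟨j - i, List.mem_range.2 (by omega), rfl⟩) ?_
    rw [show i + (j - i) = j by omega]
    exact hc
  -- No colour is avoided at `x`: one closed walk sees them all, and its infinite repetition is both
  -- accepted and refuted.
  · obtain ⟨i, -, hi⟩ := frequently_atTop.1 hx 0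
    obtain ⟨k, hk, hkx⟩ := frequently_atTop.1 hx (i + 1)
    have hwalk := hv.isWalk i (k - i)
    rw [show i + (k - i) = k by omega, hi, hkx] at hwalk
    obtain ⟨l, hl, hlw, hlc⟩ := exists_closed_walk_through
      (M := fun c => {e | (e.1.1, e.2.1, e.2.2.1) ∈ F c}) ⟨_, by simp; omega, hwalk⟩
      (fun c => by
        by_contra! hcon
        exact hA ⟨c, fun l hl e he => hcon l hl e he⟩)
    obtain ⟨r', y, hr', hr0, hrec⟩ := exists_path_of_walks (prodGraph T E)
      (fun _ : Unit => x) id (fun _ => l) (fun _ => hl) (fun _ => hlw) ()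
    have h1 : y ∈ recLang T F (r (t + i)) := by
      refine ⟨fun n => (r' n).1, ?_, fun n => (hr' n).1, fun c => ?_⟩
      · exact congrArg Prod.fst (hr0.trans hi.symm)
      · obtain ⟨e, he, hec⟩ := hlc c
        rw [frequently_atTop]
        intro n
        obtain ⟨j, hj, rfl⟩ := hrec n e he
        exact ⟨j, hj, hec⟩
    have h2 : y ∈ pathLang E (π i) := mem_pathLang.2
      ⟨fun n => (r' n).2, congrArg Prod.snd (hr0.trans hi.symm), fun n => (hr' n).2⟩
    refine hν.append (hπ.steps_take i) y h2 ?_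
    rw [← take_add]
    exact recLang_lapp (hr.steps_take _) h1

end Recolour

/-! ### Strategies, covering and restarting -/

section Strategies

variable {S Q : Type*}

/-- `f` maps every finite word to the state reached by a strategy that follows edges of `T`. -/
def IsStrat (T : Set (Q × S × Q)) (f : List S → Q) : Prop :=
  ∀ u a, (f u, a, f (u ++ [a])) ∈ T

/-- The strategy that remains after the letter `a`. -/
def stratTail (f : List S → Q) (a : S) : List S → Q := fun u => f (a :: u)

/-- The strategy uses an edge of `F` while reading the word. -/
def Hits (F : Set (Q × S × Q)) : List S → (List S → Q) → Prop
  | [], _ => False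
  | a :: u, f => (f [], a, f [a]) ∈ F ∨ Hits F u (stratTail f a)

/-- Some path of `T` from the state over the word uses an edge of `F`. -/
def Reaches (T F : Set (Q × S × Q)) : List S → Q → Prop
  | [], _ => False
  | a :: u, q => ∃ q', (q, a, q') ∈ T ∧ ((q, a, q') ∈ F ∨ Reaches T F u q')

variable {T F : Set (Q × S × Q)}

theorem IsStrat.tail {f : List S → Q} (hf : IsStrat T f) (a : S) : IsStrat T (stratTail f a) :=
  fun u b => hf (a :: u) b

theorem IsStrat.reaches {f : List S → Q} (hf : IsStrat T f) {u : List S} (h : Hits F u f) :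
    Reaches T F u (f []) := by
  induction u generalizing f with
  | nil => exact h
  | cons a u ih => exact ⟨f [a], hf [] a, h.imp id fun h => ih (hf.tail a) h⟩

theorem Hits.exists_lt {f : List S → Q} {y : ℕ → S} {n : ℕ} (h : Hits F (take y n) f) :
    ∃ i < n, (f (take y i), y i, f (take y (i + 1))) ∈ F := by
  induction n generalizing f y with
  | zero => exact h.elim
  | succ n ih =>
    rw [take_succ_cons] at h
    rcases h with h | h
    · exact ⟨0, by omega, h⟩
    · obtain ⟨i, hi, h⟩ := ih h
      refine ⟨i + 1, by omega, ?_⟩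
      rw [take_succ_cons, take_succ_cons y (i + 1)]
      rwa [drop, add_comm 1 i] at h

/-- The strategy `f` hits `F` no later than any path from `q`. -/
def CoversBy (T F : Set (Q × S × Q)) (f : List S → Q) (q : Q) : Prop :=
  ∀ u, Reaches T F u q → Hits F u f

/-- As long as the strategy has not hit `F`, it still owes a hit to every continuation of the other
path. -/
theorem CoversBy.tail {f : List S → Q} {q q' : Q} {a : S} (h : CoversBy T F f q)
    (hq : (q, a, q') ∈ T) (hf : (f [], a, f [a]) ∉ F) : CoversBy T F (stratTail f a) q' :=
  fun u hu => (h (a :: u) ⟨q', hq, Or.inr hu⟩).resolve_left hf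

open Classical in
/-- Follow `f`, but switch to the strategy `g p` in case an edge of `R` has led to `p`. -/
noncomputable def restartStep (R : Set (Q × S × Q)) (g : Q → List S → Q) (f : List S → Q)
    (a : S) : List S → Q :=
  if (f [], a, f [a]) ∈ R then g (f [a]) else stratTail f a

/-- The strategy that follows `f` and restarts with `g` after each edge of `R`. -/
noncomputable def restart (R : Set (Q × S × Q)) (g : Q → List S → Q) (f : List S → Q)
    (u : List S) : Q :=
  u.foldl (restartStep R g) f []

variable {R : Set (Q × S × Q)} {g : Q → List S → Q}

theorem restart_singleton (hg : ∀ p, g p [] = p) (f : List S → Q) (a : S) :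
    restart R g f [a] = f [a] := by
  simp only [restart, List.foldl, restartStep]
  split_ifs
  exacts [hg _, rfl]

/-- The strategy in force is always either a fresh `g p` or the tail of its predecessor after an
edge outside `R`. -/
theorem restart_invariant {Inv : (List S → Q) → Prop} (hgI : ∀ p, Inv (g p))
    (hI : ∀ f, Inv f → ∀ a, (f [], a, f [a]) ∉ R → Inv (stratTail f a))
    {f : List S → Q} (hf : Inv f) (u : List S) : Inv (u.foldl (restartStep R g) f) := by
  induction u generalizing f with
  | nil => exact hf
  | cons a u ih =>
    refine ih ?_
    rw [restartStep]
    split_ifs with h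
    exacts [hgI _, hI f hf a h]

theorem isStrat_restart {Inv : (List S → Q) → Prop} (hg : ∀ p, g p [] = p) (hgI : ∀ p, Inv (g p))
    (hI : ∀ f, Inv f → ∀ a, (f [], a, f [a]) ∉ R → Inv (stratTail f a))
    (hT : ∀ f, Inv f → ∀ a, (f [], a, f [a]) ∈ T)
    {f : List S → Q} (hf : Inv f) : IsStrat T (restart R g f) := by
  intro u a
  have h := hT _ (restart_invariant hgI hI hf u) a
  rw [← restart_singleton (R := R) hg (u.foldl (restartStep R g) f)] at h
  simpa [restart] using h

theorem hits_restart (hg : ∀ p, g p [] = p) (hFR : F ⊆ R) {f : List S → Q} {u : List S}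
    (h : Hits F u f) : Hits R u (restart R g f) := by
  induction u generalizing f with
  | nil => exact h
  | cons a u ih =>
    rw [Hits, restart_singleton hg]
    by_cases hR : (f [], a, f [a]) ∈ R
    · exact Or.inl hR
    · have h1 : restartStep R g f a = stratTail f a := if_neg hR
      have := ih (h.resolve_left fun h => hR (hFR h))
      rw [← h1] at this
      exact Or.inr this

/-! ### Making every state covering -/

/-- A Büchi automaton with transitions `T` and accepting transitions `F` in which every transition
respects the residuals `Λ` and every state resolves its nondeterminism. -/
structure IsResolving (Λ : Q → Set (ℕ → S)) (T F : Set (Q × S × Q)) : Prop where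
  sub : F ⊆ T
  resid : ∀ {p a p'}, (p, a, p') ∈ T → ∀ y, scons a y ∈ Λ p ↔ y ∈ Λ p'
  sound : ∀ p, recLang T (fun _ : Unit => F) p ⊆ Λ p
  strat : ∀ p, ∃ f, IsStrat T f ∧ f [] = p ∧ ∀ w ∈ Λ p, ∃ n, Hits F (take w n) f

namespace IsResolving

variable {Λ : Q → Set (ℕ → S)}

theorem congr (h : IsResolving Λ T F) {p q p' q' : Q} {a : S} (hp : (p, a, p') ∈ T)
    (hq : (q, a, q') ∈ T) (hΛ : Λ q = Λ p) : Λ q' = Λ p' := by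
  ext y
  rw [← h.resid hp, ← h.resid hq, hΛ]

theorem lapp_mem_iff (h : IsResolving Λ T F) {p p' : Q} {u : List S} (hu : Steps T p u p')
    (y : ℕ → S) : lapp u y ∈ Λ p ↔ y ∈ Λ p' := by
  induction u generalizing p with
  | nil => cases hu; rfl
  | cons a u ih =>
    obtain ⟨x, hx, hu⟩ := hu
    exact (h.resid hx _).trans (ih hu)

theorem exists_reaches (h : IsResolving Λ T F) {q : Q} {w : ℕ → S} (hw : w ∈ Λ q) :
    ∃ n, Reaches T F (take w n) q := by
  obtain ⟨f, hf, rfl, hfw⟩ := h.strat q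
  obtain ⟨n, hn⟩ := hfw w hw
  exact ⟨n, hf.reaches hn⟩

end IsResolving

/-- The strategy `f` hits `F` no later than any path from some state with the same residual. -/
def CoversSome (Λ : Q → Set (ℕ → S)) (T F : Set (Q × S × Q)) (f : List S → Q) : Prop :=
  ∃ q, Λ q = Λ (f []) ∧ CoversBy T F f q

/-- The states from which some strategy covers an equivalent state. -/
def coverStates (Λ : Q → Set (ℕ → S)) (T F : Set (Q × S × Q)) : Set Q :=
  {p | ∃ f, IsStrat T f ∧ f [] = p ∧ CoversSome Λ T F f}

namespace IsResolving

variable {Λ : Q → Set (ℕ → S)}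

theorem coversSome_tail (h : IsResolving Λ T F) {f : List S → Q} (hf : IsStrat T f)
    (hc : CoversSome Λ T F f) {a : S} (ha : (f [], a, f [a]) ∉ F) :
    CoversSome Λ T F (stratTail f a) := by
  obtain ⟨q, hq, hc⟩ := hc
  obtain ⟨k, hk, rfl, -⟩ := h.strat q
  exact ⟨k [a], h.congr (hf [] a) (hk [] a) hq, hc.tail (hk [] a) ha⟩

theorem exists_strat_coverStates (h : IsResolving Λ T F) (p : Q) :
    ∃ f, (IsStrat T f ∧ (f [] ∈ coverStates Λ T F → CoversSome Λ T F f)) ∧ f [] = p ∧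
      ∀ w ∈ Λ p, ∃ n, Hits F (take w n) f := by
  by_cases hp : p ∈ coverStates Λ T F
  · obtain ⟨f, hf, rfl, hc⟩ := hp
    refine ⟨f, ⟨hf, fun _ => hc⟩, rfl, fun w hw => ?_⟩
    obtain ⟨q, hq, hc⟩ := hc
    obtain ⟨n, hn⟩ := h.exists_reaches (hq ▸ hw)
    exact ⟨n, hc _ hn⟩
  · obtain ⟨f, hf, rfl, hw⟩ := h.strat p
    exact ⟨f, ⟨hf, fun hp' => (hp hp').elim⟩, rfl, hw⟩

/-- Deleting the rejecting transitions that leave the covering states and accepting those that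
enter them changes neither the residuals nor the resolvability. -/
theorem improve (h : IsResolving Λ T F) :
    IsResolving Λ {e ∈ T | e ∈ F ∨ (e.1 ∈ coverStates Λ T F → e.2.2 ∈ coverStates Λ T F)}
      {e ∈ T | e ∈ F ∨ (e.1 ∉ coverStates Λ T F ∧ e.2.2 ∈ coverStates Λ T F)} := by
  set V := coverStates Λ T F with hV
  refine ⟨fun e he => ⟨he.1, he.2.imp id fun h _ => h.2⟩, fun hp => h.resid hp.1, ?_, ?_⟩
  -- After the last edge of the old `F`, a run that enters `V` can never leave it, so it uses at
  -- most one more new accepting edge.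
  · rintro _ w ⟨r, rfl, hr, hF⟩
    refine h.sound _ ⟨r, rfl, fun i => (hr i).1, fun _ => ?_⟩
    by_contra hcon
    obtain ⟨N, hN⟩ := eventually_atTop.1 (not_frequently.1 hcon)
    have hfr := frequently_atTop.1 (hF ())
    obtain ⟨i, hi, -, hiF⟩ := hfr N
    have hiV := (hiF.resolve_left (hN i hi)).2
    have hstay : ∀ j ≥ i + 1, r j ∈ V := by
      intro j hj
      induction j, hj using Nat.le_induction with
      | base => exact hiV
      | succ j hj ih => exact (hr j).2.resolve_left (hN j (by omega)) ih
    obtain ⟨j, hj, -, hjF⟩ := hfr (i + 1)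
    exact (hjF.resolve_left (hN j (by omega))).1 (hstay j hj)
  · choose g hgI hg hgw using h.exists_strat_coverStates
    intro p
    -- Restarting after each accepting edge keeps the strategy covering while it is in `V`; a
    -- covering strategy only leaves `V` through `F`, so it uses no deleted edge.
    refine ⟨restart {e ∈ T | e ∈ F ∨ (e.1 ∉ V ∧ e.2.2 ∈ V)} g (g p),
      isStrat_restart (Inv := fun f => IsStrat T f ∧ (f [] ∈ V → CoversSome Λ T F f)) hg hgI ?_ ?_ (hgI p), hg p, fun w hw => ?_⟩
    · rintro f ⟨hf, hfV⟩ a ha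
      refine ⟨hf.tail a, fun hV' => ?_⟩
      have haF : (f [], a, f [a]) ∉ F := fun hF => ha ⟨hf [] a, Or.inl hF⟩
      have : f [] ∈ V := by
        by_contra hcon
        exact ha ⟨hf [] a, Or.inr ⟨hcon, hV'⟩⟩
      exact h.coversSome_tail hf (hfV this) haF
    · rintro f ⟨hf, hfV⟩ a
      refine ⟨hf [] a, ?_⟩
      by_cases haF : (f [], a, f [a]) ∈ F
      · exact Or.inl haF
      · refine Or.inr fun hp => ?_
        exact ⟨stratTail f a, hf.tail a, rfl, h.coversSome_tail hf (hfV hp) haF⟩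
    · obtain ⟨n, hn⟩ := hgw p w hw
      have hsub : F ⊆ {e ∈ T | e ∈ F ∨ (e.1 ∉ V ∧ e.2.2 ∈ V)} := fun _ he => ⟨h.sub he, Or.inl he⟩
      exact ⟨n, hits_restart hg hsub hn⟩

/-- The play of a strategy against an independent path, while the strategy avoids `F`. -/
def raceGraph (T F : Set (Q × S × Q)) : Set (((List S → Q) × Q) × S × ((List S → Q) × Q)) :=
  {e | e.2.2.1 = stratTail e.1.1 e.2.1 ∧ (e.1.2, e.2.1, e.2.2.2) ∈ T ∧
    (e.1.1 [], e.2.1, e.1.1 [e.2.1]) ∉ F}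

theorem exists_race_walk {u : List S} {q : Q} {f : List S → Q} (hq : Reaches T F u q)
    (hf : ¬ Hits F u f) :
    ∃ l z, IsWalk (raceGraph T F) (f, q) l z ∧ ∃ e ∈ l, (e.1.2, e.2.1, e.2.2.2) ∈ F := by
  induction u generalizing q f with
  | nil => exact hq.elim
  | cons a u ih =>
    obtain ⟨q', hT, hq⟩ := hq
    simp only [Hits, not_or] at hf
    have hG : ((f, q), a, (stratTail f a, q')) ∈ raceGraph T F := ⟨rfl, hT, hf.1⟩
    rcases hq with hF | hq
    · exact ⟨[_], _, ⟨hG, rfl, rfl⟩, _, List.mem_singleton_self _, hF⟩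
    · obtain ⟨l, z, hl, e, he, hF⟩ := ih hq hf.2
      exact ⟨_ :: l, z, ⟨hG, rfl, hl⟩, e, List.mem_cons_of_mem _ he, hF⟩

theorem not_hits_of_race {r : ℕ → (List S → Q) × Q} {w : ℕ → S} (hr : IsPath (raceGraph T F) r w)
    (n : ℕ) : ¬ Hits F (take w n) (r 0).1 := by
  induction n generalizing r w with
  | zero => exact id
  | succ n ih =>
    rw [take_succ_cons]
    rintro (h | h)
    · exact (hr 0).2.2 h
    · exact ih (hr.drop 1) ((hr 0).1 ▸ h)

/-- If no rejecting transition enters or leaves the covering states, all states are covering. -/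
theorem coverStates_eq_univ (h : IsResolving Λ T F)
    (hV : ∀ e ∈ T, e ∉ F → (e.1 ∈ coverStates Λ T F ↔ e.2.2 ∈ coverStates Λ T F)) :
    coverStates Λ T F = Set.univ := by
  rw [Set.eq_univ_iff_forall]
  intro p
  by_contra hp
  set V := coverStates Λ T F
  -- A strategy outside `V` covers no equivalent state, so an independent path can reach `F`
  -- strictly before it. Rejecting edges do not enter `V`, so this repeats forever: the path accepts
  -- a word on which the strategy never hits `F`.
  let Good : (List S → Q) × Q → Prop :=
    fun z => IsStrat T z.1 ∧ z.1 [] ∉ V ∧ Λ z.2 = Λ (z.1 [])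
  have hgood : ∀ {l z z'}, IsWalk (raceGraph T F) z l z' → Good z → Good z' := by
    intro l
    induction l with
    | nil => rintro z z' rfl hz; exact hz
    | cons e l ih =>
      rintro z z' ⟨⟨h1, h2, h3⟩, rfl, hl⟩ ⟨g1, g2, g3⟩
      refine ih hl ⟨h1 ▸ g1.tail _, ?_, ?_⟩
      · rw [h1]
        exact fun hcon => g2 ((hV _ (g1 [] e.2.1) h3).2 hcon)
      · rw [h1]
        exact h.congr (g1 [] e.2.1) h2 g3
  have hnext : ∀ z : {z // Good z}, ∃ l, ∃ z' : {z // Good z},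
      IsWalk (raceGraph T F) z.1 l z'.1 ∧ ∃ e ∈ l, (e.1.2, e.2.1, e.2.2.2) ∈ F := by
    rintro ⟨⟨f, q⟩, hz⟩
    have hnc : ¬ CoversBy T F f q := fun hc => hz.2.1 ⟨f, hz.1, rfl, q, hz.2.2, hc⟩
    simp only [CoversBy, not_forall] at hnc
    obtain ⟨u, hu, hf⟩ := hnc
    obtain ⟨l, z', hl, hF⟩ := exists_race_walk hu hf
    exact ⟨l, ⟨z', hgood hl hz⟩, hl, hF⟩
  choose l nxt hw hF using hnext
  obtain ⟨f, hf, rfl, hfw⟩ := h.strat p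
  obtain ⟨r, w, hr, hr0, hrec⟩ := exists_path_of_walks (raceGraph T F) Subtype.val nxt l
    (fun z hz => by obtain ⟨e, he, -⟩ := hF z; rw [hz] at he; exact List.not_mem_nil he) hw
    ⟨(f, f []), hf, hp, rfl⟩
  have hmem : w ∈ Λ (f []) := by
    refine h.sound _ ⟨fun i => (r i).2, congrArg Prod.snd hr0, fun i => (hr i).2.1, fun _ => ?_⟩
    rw [frequently_atTop]
    intro n
    obtain ⟨e, he, heF⟩ := hF (nxt^[n] ⟨(f, f []), hf, hp, rfl⟩)
    obtain ⟨i, hi, rfl⟩ := hrec n e he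
    exact ⟨i, hi, heF⟩
  obtain ⟨n, hn⟩ := hfw w hmem
  refine not_hits_of_race hr n ?_
  rwa [hr0]

/-- Some choice of transitions makes all states covering, with the same residuals. -/
theorem exists_coverStates_eq_univ [Finite S] [Finite Q] (h : IsResolving Λ T F) :
    ∃ T' F', IsResolving Λ T' F' ∧ coverStates Λ T' F' = Set.univ := by
  induction hn : (T \ F).ncard using Nat.strong_induction_on generalizing T F with
  | _ n ih =>
    subst hn
    set T' := {e ∈ T | e ∈ F ∨ (e.1 ∈ coverStates Λ T F → e.2.2 ∈ coverStates Λ T F)} with hT'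
    set F' := {e ∈ T | e ∈ F ∨ (e.1 ∉ coverStates Λ T F ∧ e.2.2 ∈ coverStates Λ T F)} with hF'
    have hsub : T' \ F' ⊆ T \ F := fun e he => ⟨he.1.1, fun hF => he.2 ⟨he.1.1, Or.inl hF⟩⟩
    -- Either an improvement removes a rejecting transition, or none enters or leaves the covering
    -- states.
    by_cases heq : T \ F ⊆ T' \ F'
    · refine ⟨T, F, h, h.coverStates_eq_univ fun e he heF => ⟨fun h1 => ?_, fun h2 => ?_⟩⟩
      · exact ((heq ⟨he, heF⟩).1.2.resolve_left heF) h1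
      · by_contra h1
        exact (heq ⟨he, heF⟩).2 ⟨he, Or.inr ⟨h1, h2⟩⟩
    · exact ih _ (Set.ncard_lt_ncard ⟨hsub, heq⟩ (Set.toFinite _)) h.improve rfl

end IsResolving

/-! ### The safe graph as a witness of the complement -/

/-- Iterating a choice of successors must repeat in a finite set, and transitivity turns the
repetition into a loop. -/
theorem exists_rel_self_of_trans {X : Type*} [Finite X] {r : X → X → Prop}
    (htrans : ∀ {x y z}, r x y → r y z → r x z) (hr : ∀ x, ∃ y, r x y) (x : X) :
    ∃ y, r x y ∧ r y y := by
  choose m hm using hr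
  have hlt : ∀ i d, r (m^[i] x) (m^[i + d + 1] x) := by
    intro i d
    induction d with
    | zero => rw [add_zero, Function.iterate_succ_apply']; exact hm _
    | succ d ih => rw [← add_assoc, Function.iterate_succ_apply']; exact htrans ih (hm _)
  obtain ⟨i, j, hij, h⟩ := Finite.exists_ne_map_eq_of_infinite (fun i : ℕ => m^[i + 1] x)
  wlog hlt' : i < j generalizing i j
  · exact this j i hij.symm h.symm (by omega)
  refine ⟨m^[i + 1] x, by simpa using hlt 0 i, ?_⟩
  have := hlt (i + 1) (j - i - 1)
  rw [show i + 1 + (j - i - 1) + 1 = j + 1 by omega] at this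
  have h' : m^[i + 1] x = m^[j + 1] x := h
  rwa [← h'] at this

/-- Edges along which no acceptance is lost. -/
def safeGraph (T F : Set (Q × S × Q)) : Set (Q × S × Q) :=
  {e | ∀ v, Reaches T F (e.2.1 :: v) e.1 → Reaches T F v e.2.2}

/-- A possible acceptance would be passed on by every safe edge until the finite word is exhausted,
where none is left. -/
theorem not_reaches_of_safe {π : ℕ → Q} {y : ℕ → S} (h : IsPath (safeGraph T F) π y) (n : ℕ) :
    ¬ Reaches T F (take y n) (π 0) := by
  induction n generalizing π y with
  | zero => exact id
  | succ n ih =>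
    rw [take_succ_cons]
    exact fun hc => ih (h.drop 1) (h 0 _ hc)

/-- A strategy covering its own start covers its current state until it hits `F`. All of its edges
are then safe: what the current state can reach, the strategy itself must still reach. -/
theorem mem_pathLang_safeGraph {f : List S → Q} {y : ℕ → S} (hf : IsStrat T f)
    (hc : CoversBy T F f (f [])) (hy : ∀ n, ¬ Reaches T F (take y n) (f [])) :
    y ∈ pathLang (safeGraph T F) (f []) := by
  have hnot : ∀ n, ¬ Hits F (take y n) f := fun n hn => hy n (hf.reaches hn)
  have hstep : ∀ (k : List S → Q) (a : S), IsStrat T k → CoversBy T F k (k []) →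
      (k [], a, k [a]) ∉ F → (k [], a, k [a]) ∈ safeGraph T F :=
    fun k a hk hkc ha v hv => (hk.tail a).reaches ((hkc _ hv).resolve_left ha)
  let m : ℕ → List S → Q := fun i => (take y i).foldl stratTail f
  have hm : ∀ i, m (i + 1) = stratTail (m i) (y i) := fun i => by simp [m, take_succ]
  have hinv : ∀ i, IsStrat T (m i) ∧ CoversBy T F (m i) (m i []) ∧
      ∀ n, ¬ Hits F (take (drop y i) n) (m i) := by
    intro i
    induction i with
    | zero =>
      refine ⟨hf, hc, fun n => ?_⟩
      have : drop y 0 = y := by funext j; simp [drop]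
      rw [this]
      exact hnot n
    | succ i ih =>
      obtain ⟨h1, h2, h3⟩ := ih
      have h0 : (m i [], y i, m i [y i]) ∉ F := fun hF => h3 1 (Or.inl hF)
      rw [hm]
      refine ⟨h1.tail _, h2.tail (h1 [] _) h0, fun n hn => h3 (n + 1) ?_⟩
      rw [take_succ_cons, drop_drop]
      exact Or.inr hn
  refine mem_pathLang.2 ⟨fun i => m i [], rfl, fun i => ?_⟩
  obtain ⟨h1, h2, h3⟩ := hinv i
  simp only [hm]
  exact hstep _ _ h1 h2 fun hF => h3 1 (Or.inl hF)

/-- The words outside `Λ p` are witnessed by the paths of the safe graph. -/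
theorem IsResolving.exists_refutes [Finite Q] {Λ : Q → Set (ℕ → S)} (h : IsResolving Λ T F)
    (hV : coverStates Λ T F = Set.univ) {p : Q} {w : ℕ → S} (hw : w ∉ Λ p) :
    ∃ t ν, Refutes (safeGraph T F) (Λ p) (take w t) ν ∧
      drop w t ∈ pathLang (safeGraph T F) ν := by
  have hV' : ∀ p, ∃ f, (IsStrat T f ∧ CoversSome Λ T F f) ∧ f [] = p := fun p => by
    obtain ⟨f, hf, hp, hc⟩ := hV.ge (Set.mem_univ p)
    exact ⟨f, ⟨hf, hc⟩, hp⟩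
  choose g hgI hg using hV'
  have hI : ∀ f, IsStrat T f ∧ CoversSome Λ T F f → ∀ a, (f [], a, f [a]) ∉ F →
      IsStrat T (stratTail f a) ∧ CoversSome Λ T F (stratTail f a) :=
    fun f hf a ha => ⟨hf.1.tail a, h.coversSome_tail hf.1 hf.2 ha⟩
  -- Since `w` is rejected, the strategy that restarts after each accepting edge accepts only
  -- finitely often along it. After time `t` it is a covering strategy that never hits `F`, so the
  -- covered state `q` cannot reach `F` either.
  have hs : IsStrat T (restart F g (g p)) :=
    isStrat_restart hg hgI hI (fun f hf a => hf.1 [] a) (hgI p)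
  let r : ℕ → Q := fun i => restart F g (g p) (take w i)
  have hr : IsPath T r w := fun i => by
    have := hs (take w i) (w i)
    rwa [← take_succ] at this
  have hr0 : r 0 = p := hg p
  have hnF : ¬ ∃ᶠ i in atTop, (r i, w i, r (i + 1)) ∈ F :=
    fun hF => hw (h.sound p ⟨r, hr0, hr, fun _ => hF⟩)
  obtain ⟨t, ht⟩ := eventually_atTop.1 (not_frequently.1 hnF)
  set k := (take w t).foldl (restartStep F g) (g p) with hk
  obtain ⟨hks, q, hq, hkq⟩ : IsStrat T k ∧ CoversSome Λ T F k :=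
    restart_invariant hgI hI (hgI p) (take w t)
  have hnot : ∀ n, ¬ Reaches T F (take (drop w t) n) q := by
    intro n hn
    obtain ⟨i, -, hi⟩ := (hits_restart (R := F) hg le_rfl (hkq _ hn)).exists_lt
    have hri : ∀ i, restart F g k (take (drop w t) i) = r (t + i) := fun i => by
      simp [r, restart, take_add, hk]
    rw [hri, hri] at hi
    exact ht (t + i) (by omega) hi
  -- Covering among equivalent states is transitive and total, so `q` covers some `ν` that covers
  -- itself; `ν` inherits from `q` that it cannot reach `F`.
  obtain ⟨ν, ⟨hν1, hν2⟩, hν3, f, hf, rfl, hff⟩ := exists_rel_self_of_trans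
    (r := fun x y => Λ y = Λ x ∧ ∃ f, IsStrat T f ∧ f [] = x ∧ CoversBy T F f y)
    (fun {x y z} ⟨h1, f, hf, hfx, hfy⟩ ⟨h2, k, hk, hky, hkz⟩ =>
      ⟨h2.trans h1, f, hf, hfx, fun u hu => hfy u (hky ▸ hk.reaches (hkz u hu))⟩)
    (fun x => by
      obtain ⟨hs, y, hy, hc⟩ := hgI x
      exact ⟨y, by rw [hy, hg], g x, hs, hg x, hc⟩) q
  obtain ⟨k', hk', rfl, hkc⟩ := hν2
  refine ⟨t, f [], fun y hy => ?_, mem_pathLang_safeGraph hf hff fun n hn =>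
    hnot n (hk'.reaches (hkc _ hn))⟩
  obtain ⟨π, h0, hπ⟩ := mem_pathLang.1 hy
  rw [← hr0, h.lapp_mem_iff (hr.steps_take t), show r t = k [] from rfl, ← hq, ← hν1]
  intro hcon
  obtain ⟨n, hn⟩ := h.exists_reaches hcon
  exact not_reaches_of_safe hπ n (h0 ▸ hn)

end Strategies

/-! ### Degeneralising along a resolver -/

section Degeneralise

variable {S Q C : Type*}

theorem exists_cyclic (C : Type*) [Finite C] [Nonempty C] :
    ∃ nx : C → C, ∀ x y, ∃ d, nx^[d] x = y := by
  obtain ⟨k, ⟨e⟩⟩ := Finite.exists_equiv_fin C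
  have : NeZero k := ⟨by rintro rfl; exact (e (Classical.arbitrary C)).elim0⟩
  refine ⟨fun c => e.symm (e c + 1), fun x y => ⟨(e y - e x).val, ?_⟩⟩
  have h : ∀ d : ℕ, (fun c => e.symm (e c + 1))^[d] x = e.symm (e x + (Fin.ofNat k d)) := by
    intro d
    induction d with
    | zero => simp
    | succ d ih =>
      rw [Function.iterate_succ_apply', ih, Equiv.apply_symm_apply, add_assoc]
      congr 2
      ext
      simp [Fin.val_add]
  rw [h]
  simp

section Cycle

variable {nx : C → C} {A : ℕ → C → Prop} {j : ℕ → C}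

open Classical in
theorem frequently_current (hj : ∀ i, j (i + 1) = if A i (j i) then nx (j i) else j i)
    (hA : ∀ c, ∃ᶠ i in atTop, A i c) : ∃ᶠ i in atTop, A i (j i) := by
  by_contra hcon
  obtain ⟨N, hN⟩ := eventually_atTop.1 (not_frequently.1 hcon)
  have hconst : ∀ i ≥ N, j i = j N := by
    intro i hi
    induction i, hi using Nat.le_induction with
    | base => rfl
    | succ i hi ih => rw [hj, if_neg (hN i hi), ih]
  obtain ⟨i, hi, hAi⟩ := frequently_atTop.1 (hA (j N)) N
  exact hN i hi (by rwa [hconst i hi])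

open Classical in
theorem frequently_of_current (hnx : ∀ x y, ∃ d, nx^[d] x = y)
    (hj : ∀ i, j (i + 1) = if A i (j i) then nx (j i) else j i)
    (hA : ∃ᶠ i in atTop, A i (j i)) (c : C) : ∃ᶠ i in atTop, A i c := by
  -- Up to its next occurrence the awaited colour does not change.
  have hfirst : ∀ N, ∃ i ≥ N, A i (j i) ∧ j i = j N := by
    intro N
    obtain ⟨i, hi, hAi⟩ := frequently_atTop.1 hA N
    obtain ⟨d, rfl⟩ := Nat.exists_eq_add_of_le hi
    clear hi
    induction d generalizing N with
    | zero => exact ⟨N, le_rfl, hAi, rfl⟩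
    | succ d ih =>
      by_cases hN : A N (j N)
      · exact ⟨N, le_rfl, hN, rfl⟩
      · obtain ⟨i, hi, h1, h2⟩ := ih (N + 1) (by rwa [add_assoc, add_comm 1 d])
        exact ⟨i, by omega, h1, by rw [h2, hj, if_neg hN]⟩
  have hiter : ∀ d N, ∃ i ≥ N, A i (j i) ∧ j i = nx^[d] (j N) := by
    intro d
    induction d with
    | zero => exact hfirst
    | succ d ih =>
      intro N
      obtain ⟨i, hi, h1, h2⟩ := ih N
      obtain ⟨i', hi', h1', h2'⟩ := hfirst (i + 1)
      refine ⟨i', by omega, h1', ?_⟩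
      rw [h2', hj, if_pos h1, h2, Function.iterate_succ_apply']
  rw [frequently_atTop]
  intro N
  obtain ⟨d, hd⟩ := hnx (j N) c
  obtain ⟨i, hi, h1, h2⟩ := hiter d N
  exact ⟨i, hi, by rwa [h2, hd] at h1⟩

end Cycle

open Classical in
/-- The colour that the strategy `f` is waiting for, starting with `c₀` and proceeding along `nx`. -/
noncomputable def awaited (F : C → Set (Q × S × Q)) (nx : C → C) (c₀ : C) (f : List S → Q)
    (u : List S) : C :=
  (u.foldl (fun (p : List S × C) a =>
    (p.1 ++ [a], if (f p.1, a, f (p.1 ++ [a])) ∈ F p.2 then nx p.2 else p.2)) ([], c₀)).2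

open Classical in
theorem awaited_append (F : C → Set (Q × S × Q)) (nx : C → C) (c₀ : C) (f : List S → Q)
    (u : List S) (a : S) : awaited F nx c₀ f (u ++ [a]) =
      if (f u, a, f (u ++ [a])) ∈ F (awaited F nx c₀ f u) then nx (awaited F nx c₀ f u)
      else awaited F nx c₀ f u := by
  have hfst : ∀ u : List S, (u.foldl (fun (p : List S × C) a =>
      (p.1 ++ [a], if (f p.1, a, f (p.1 ++ [a])) ∈ F p.2 then nx p.2 else p.2)) ([], c₀)).1
        = u := by
    intro u
    induction u using List.reverseRecOn with
    | nil => rfl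
    | append_singleton u a ih => rw [List.foldl_append, List.foldl_cons, List.foldl_nil, ih]
  rw [awaited, List.foldl_append, List.foldl_cons, List.foldl_nil, hfst]
  rfl

theorem IsStrat.steps {T : Set (Q × S × Q)} {f : List S → Q} (hf : IsStrat T f) (u : List S) :
    Steps T (f []) u (f u) := by
  induction u generalizing f with
  | nil => rfl
  | cons a u ih => exact ⟨f [a], hf [] a, ih (hf.tail a)⟩

theorem hits_of_mem {F : Set (Q × S × Q)} {f : List S → Q} {y : ℕ → S} {i : ℕ}
    (h : (f (take y i), y i, f (take y (i + 1))) ∈ F) : Hits F (take y (i + 1)) f := by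
  induction i generalizing f y with
  | zero => exact Or.inl h
  | succ i ih =>
    rw [take_succ_cons]
    refine Or.inr (ih ?_)
    rw [take_succ_cons, take_succ_cons y (i + 1)] at h
    rw [drop, add_comm 1 i]
    exact h

/-- `f` resolves the nondeterminism of the generalised Büchi automaton with transitions `T`,
acceptance sets `F` and initial state `q₀`. -/
def Resolves (T : Set (Q × S × Q)) (F : C → Set (Q × S × Q)) (q₀ : Q) (f : List S → Q) : Prop :=
  IsStrat T f ∧ f [] = q₀ ∧ ∀ w ∈ recLang T F q₀, ∀ c, ∃ᶠ i in atTop,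
    (f (take w i), w i, f (take w (i + 1))) ∈ F c

/-- The states of the degeneralised automaton that the strategy visits. -/
abbrev Visited (st : List S → Q × C) : Type _ := Set.range st

/-- The transitions of the degeneralised automaton that the strategy uses. -/
def visitedTrans (st : List S → Q × C) : Set (Visited st × S × Visited st) :=
  {e | ∃ u, st u = e.1 ∧ st (u ++ [e.2.1]) = e.2.2}

/-- The transitions on which the awaited colour is seen. -/
def visitedAcc (F : C → Set (Q × S × Q)) (st : List S → Q × C) :
    Set (Visited st × S × Visited st) :=
  {e ∈ visitedTrans st | (e.1.1.1, e.2.1, e.2.2.1.1) ∈ F e.1.1.2}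

section Visited

variable {T : Set (Q × S × Q)} {F : C → Set (Q × S × Q)} {q₀ : Q} {f : List S → Q}
  {nx : C → C} {c₀ : C}

theorem frequently_visitedAcc (hf : Resolves T F q₀ f) (u : List S) {y : ℕ → S}
    (hy : lapp u y ∈ recLang T F q₀) :
    ∃ᶠ i in atTop, (f (u ++ take y i), y i, f (u ++ take y (i + 1))) ∈
      F (awaited F nx c₀ f (u ++ take y i)) := by
  classical
  have htake : ∀ i, take (lapp u y) (u.length + i) = u ++ take y i := fun i => by
    rw [take_add, take_lapp, drop_lapp]
  refine frequently_current (nx := nx)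
    (A := fun i c => (f (u ++ take y i), y i, f (u ++ take y (i + 1))) ∈ F c)
    (j := fun i => awaited F nx c₀ f (u ++ take y i)) (fun i => ?_) (fun c => ?_)
  · rw [take_succ, ← List.append_assoc, awaited_append]
  · refine ((frequently_add u.length).2 (hf.2.2 _ hy c)).mono fun i hi => ?_
    rw [htake, add_assoc, htake, show lapp u y (u.length + i) = drop (lapp u y) u.length i from rfl,
      drop_lapp] at hi
    exact hi

/-- The residual depends only on the visited state, not on the history. A path in the visited graph
may mix edges from different histories, but its first components still form a run of `T` from `f u`,
and the awaited colours still evolve by the cyclic rule. -/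
theorem mem_recLang_visited_iff (hnx : ∀ x y, ∃ d, nx^[d] x = y) (hf : Resolves T F q₀ f)
    {st : List S → Q × C} (hst : st = fun u => (f u, awaited F nx c₀ f u)) (u : List S)
    (y : ℕ → S) :
    lapp u y ∈ recLang T F q₀ ↔
      y ∈ recLang (visitedTrans st) (fun _ : Unit => visitedAcc F st) ⟨st u, u, rfl⟩ := by
  classical
  constructor
  · intro hy
    have htr : ∀ i, ((⟨st (u ++ take y i), _, rfl⟩, y i, ⟨st (u ++ take y (i + 1)), _, rfl⟩) :
        Visited st × S × Visited st) ∈ visitedTrans st := fun i =>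
      ⟨u ++ take y i, rfl, by rw [take_succ, ← List.append_assoc]⟩
    refine ⟨fun i => ⟨st (u ++ take y i), _, rfl⟩, ?_, htr, fun _ => ?_⟩
    · simp [take]
    · refine (frequently_visitedAcc (nx := nx) (c₀ := c₀) hf u hy).mono fun i hi => ⟨htr i, ?_⟩
      subst hst
      exact hi
  · rintro ⟨r, h0, hr, hF⟩
    have hu := hf.1.steps u
    rw [hf.2.1] at hu
    refine recLang_lapp hu ⟨fun i => (r i).1.1, ?_, fun i => ?_, ?_⟩
    · change (r 0).1.1 = f u
      rw [h0, hst]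
    · obtain ⟨v, hv, hv'⟩ := hr i
      dsimp only at hv hv' ⊢
      rw [← hv, ← hv', hst]
      exact hf.1 v (y i)
    · refine frequently_of_current (j := fun i => (r i).1.2) hnx (fun i => ?_)
        ((hF ()).mono fun i hi => hi.2)
      obtain ⟨v, hv, hv'⟩ := hr i
      have h1 : (r i).1 = (f v, awaited F nx c₀ f v) := hv.symm.trans (congrFun hst v)
      have h2 : (r (i + 1)).1 = (f (v ++ [y i]), awaited F nx c₀ f (v ++ [y i])) :=
        hv'.symm.trans (congrFun hst _)
      simp only [h1, h2]
      exact awaited_append F nx c₀ f v (y i)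

theorem isResolving_visited (hnx : ∀ x y, ∃ d, nx^[d] x = y) (hf : Resolves T F q₀ f)
    {st : List S → Q × C} (hst : st = fun u => (f u, awaited F nx c₀ f u)) :
    IsResolving (recLang (visitedTrans st) (fun _ : Unit => visitedAcc F st))
      (visitedTrans st) (visitedAcc F st) := by
  refine ⟨fun e he => he.1, ?_, fun p => le_rfl, ?_⟩
  · rintro ⟨_, _⟩ a ⟨_, _⟩ ⟨u, hu, hu'⟩ y
    dsimp only at hu hu'
    subst hu hu'
    rw [← mem_recLang_visited_iff hnx hf hst, ← mem_recLang_visited_iff hnx hf hst, lapp_append]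
    rfl
  · rintro ⟨_, u, rfl⟩
    have hs : IsStrat (visitedTrans st) (fun v => (⟨st (u ++ v), _, rfl⟩ : Visited st)) :=
      fun v a => ⟨u ++ v, rfl, by rw [List.append_assoc]⟩
    refine ⟨_, hs, by simp, fun w hw => ?_⟩
    rw [← mem_recLang_visited_iff hnx hf hst] at hw
    obtain ⟨i, hi⟩ := (frequently_visitedAcc (nx := nx) (c₀ := c₀) hf u hw).exists
    refine ⟨i + 1, hits_of_mem ⟨?_, ?_⟩⟩
    · have := hs (take w i) (w i)
      rwa [← take_succ] at this
    · subst hst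
      exact hi

end Visited

/-- The complement of the language of a history-deterministic generalised Büchi automaton is
witnessed by the paths of a graph with one vertex for each state and colour. -/
theorem Resolves.exists_refutes.{u, v} {S : Type*} {Q : Type u} {C : Type v} [Finite S] [Finite Q]
    [Finite C] {T : Set (Q × S × Q)} {F : C → Set (Q × S × Q)} {q₀ : Q} {f : List S → Q}
    (hf : Resolves T F q₀ f) :
    ∃ (P : Type (max u v)) (_ : Finite P) (E : Set (P × S × P)),
      Nat.card P ≤ Nat.card Q * Nat.card C ∧ ∀ w ∉ recLang T F q₀,
        ∃ t ν, Refutes E (recLang T F q₀) (take w t) ν ∧ drop w t ∈ pathLang E ν := by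
  rcases isEmpty_or_nonempty C with hC | ⟨⟨c₀⟩⟩
  -- Without colours the strategy accepts every word, so there is nothing to witness.
  · refine ⟨PEmpty, inferInstance, Set.univ, by simp, fun w hw => (hw ?_).elim⟩
    refine ⟨fun i => f (take w i), hf.2.1, fun i => ?_, fun c => hC.elim c⟩
    have := hf.1 (take w i) (w i)
    rwa [← take_succ] at this
  · have : Nonempty C := ⟨c₀⟩
    obtain ⟨nx, hnx⟩ := exists_cyclic C
    obtain ⟨st, hst⟩ : ∃ st : List S → Q × C, st = fun u => (f u, awaited F nx c₀ f u) := ⟨_, rfl⟩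
    obtain ⟨T', F', h, hV⟩ := (isResolving_visited hnx hf hst).exists_coverStates_eq_univ
    have hL : recLang (visitedTrans st) (fun _ : Unit => visitedAcc F st) ⟨st [], [], rfl⟩ =
        recLang T F q₀ := by
      ext y
      rw [← mem_recLang_visited_iff hnx hf hst]
      rfl
    refine ⟨Visited st, inferInstance, safeGraph T' F', ?_, fun w hw => ?_⟩
    · rw [← Nat.card_prod]
      exact Finite.card_subtype_le _
    · rw [← hL] at hw ⊢
      exact h.exists_refutes hV hw

end Degeneralise

/-! ### Witnesses for deterministic automata -/

section Deterministic

variable {S Q C : Type*} {T : Set (Q × S × Q)} {F : C → Set (Q × S × Q)}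

theorem Steps.eq_of_det (hT : ∀ p a q q', (p, a, q) ∈ T → (p, a, q') ∈ T → q = q') {u : List S}
    {p q q' : Q} (h : Steps T p u q) (h' : Steps T p u q') : q = q' := by
  induction u generalizing p with
  | nil => exact h.symm.trans h'
  | cons a u ih =>
    obtain ⟨x, hx, h⟩ := h
    obtain ⟨x', hx', h'⟩ := h'
    cases hT _ _ _ _ hx hx'
    exact ih h h'

/-- The graph of the transitions that avoid a fixed colour. -/
def avoidGraph (T : Set (Q × S × Q)) (F : C → Set (Q × S × Q)) : Set ((Q × C) × S × (Q × C)) :=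
  {e | (e.1.1, e.2.1, e.2.2.1) ∈ T ∧ (e.1.1, e.2.1, e.2.2.1) ∉ F e.1.2 ∧ e.2.2.2 = e.1.2}

/-- A word outside the language of a deterministic automaton, all of whose prefixes extend to words
of the language, is witnessed by a path that avoids a colour. -/
theorem exists_refutes_of_det (hT : ∀ p a q q', (p, a, q) ∈ T → (p, a, q') ∈ T → q = q') {q₀ : Q}
    {w : ℕ → S} (hw : w ∉ recLang T F q₀) (hpre : ∀ t, ∃ y, lapp (take w t) y ∈ recLang T F q₀) :
    ∃ t ν, Refutes (avoidGraph T F) (recLang T F q₀) (take w t) ν ∧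
      drop w t ∈ pathLang (avoidGraph T F) ν := by
  have hs : ∀ t, ∃ q, Steps T q₀ (take w t) q := fun t => by
    obtain ⟨y, hy⟩ := hpre t
    obtain ⟨q, hq, -⟩ := recLang_of_lapp hy
    exact ⟨q, hq⟩
  choose s hs using hs
  have hpath : IsPath T s w := by
    intro t
    have h := hs (t + 1)
    rw [take_succ] at h
    obtain ⟨q, h1, p, h2, h3⟩ := h.of_append
    cases h3
    rwa [(hs t).eq_of_det hT h1]
  have h0 : s 0 = q₀ := (hs 0).symm
  -- The unique run on `w` misses some `d` from time `t` on. By determinism, any path avoiding `d`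
  -- from `s t` is the only run on its word.
  obtain ⟨d, hd⟩ : ∃ d, ¬ ∃ᶠ i in atTop, (s i, w i, s (i + 1)) ∈ F d := by
    by_contra! hcon
    exact hw ⟨s, h0, hpath, hcon⟩
  obtain ⟨t, ht⟩ := eventually_atTop.1 (not_frequently.1 hd)
  refine ⟨t, (s t, d), fun y hy hcon => ?_, mem_pathLang.2 ⟨fun i => (s (t + i), d), rfl,
    fun i => ⟨hpath _, ht _ (by omega), rfl⟩⟩⟩
  obtain ⟨π, hπ0, hπ⟩ := mem_pathLang.1 hy
  obtain ⟨q, hq, r, rfl, hr, hF⟩ := recLang_of_lapp hcon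
  have heq : ∀ i, π i = (r i, d) := by
    intro i
    induction i with
    | zero => rw [hπ0, (hs t).eq_of_det hT hq]
    | succ i ih =>
      obtain ⟨h1, -, h3⟩ := hπ i
      simp only [ih] at h1 h3
      exact Prod.ext (hT _ _ _ _ h1 (hr i)) h3
  obtain ⟨i, hi⟩ := (hF d).exists
  have := (hπ i).2.1
  rw [heq, heq] at this
  exact this hi

/-- The transitions that lead to states with nonempty language. -/
def trimmed (T : Set (Q × S × Q)) (F : C → Set (Q × S × Q)) : Set (Q × S × Q) :=
  {e ∈ T | (recLang T F e.2.2).Nonempty}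

theorem recLang_trimmed (q : Q) : recLang (trimmed T F) F q = recLang T F q := by
  ext w
  constructor
  · rintro ⟨r, h0, hr, hF⟩
    exact ⟨r, h0, fun i => (hr i).1, hF⟩
  · rintro ⟨r, h0, hr, hF⟩
    exact ⟨r, h0, fun i => ⟨hr i, _, hr.drop_mem_recLang hF (i + 1)⟩, hF⟩

theorem exists_lapp_mem_of_trimmed {q : Q} {w : ℕ → S}
    (hw : w ∈ pathLang (trimmed T F) q) (t : ℕ) : ∃ y, lapp (take w t) y ∈ recLang T F q := by
  obtain ⟨r, rfl, hr⟩ := mem_pathLang.1 hw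
  have hr' : IsPath T r w := fun i => (hr i).1
  have hne : (recLang T F (r t)).Nonempty := by
    cases t with
    | zero =>
      obtain ⟨y, hy⟩ := (hr 0).2
      exact ⟨_, recLang_scons (hr 0).1 hy⟩
    | succ t => exact (hr t).2
  obtain ⟨y, hy⟩ := hne
  exact ⟨y, recLang_lapp (hr'.steps_take t) hy⟩

end Deterministic

/-- There are finitely many labels, so a colour seen infinitely often lies in a single label that
recurs. -/
theorem mem_genBuchi_iff {C : Type*} [Finite C] {w : ℕ → Set C} :
    w ∈ genBuchi C ↔ ∀ c, ∃ᶠ i in atTop, c ∈ w i := by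
  simp only [genBuchi, infOften, Set.mem_ofPred_eq, Set.eq_univ_iff_forall, Set.mem_sUnion]
  refine forall_congr' fun c => ⟨?_, fun h => ?_⟩
  · rintro ⟨X, hX, hc⟩
    exact hX.mono fun i hi => hi ▸ hc
  · by_contra! hcon
    have hev : ∀ᶠ i in atTop, ∀ X : Set C, c ∈ X → w i ≠ X := by
      rw [Filter.eventually_all]
      intro X
      by_cases hc : c ∈ X
      · have : ¬ ∃ᶠ i in atTop, w i = X := fun h => hcon X h hc
        exact (not_frequently.1 this).mono fun i hi _ => hi
      · exact Eventually.of_forall fun i h => (hc h).elim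
    obtain ⟨i, hi, hi'⟩ := (h.and_eventually hev).exists
    exact hi' _ hi rfl

/-! ### Translation between automata and labelled graphs -/

namespace OmegaAut

variable {S Q C : Type*}

/-- `F c` consists of the transitions of `A` whose label contains `c`. -/
def ColouredBy (A : OmegaAut S Q (Set C)) (F : C → Set (Q × S × Q)) : Prop :=
  ∀ t c, c ∈ A.col t ↔ t.1 ∈ F c

/-- The transitions of `A` whose label contains `c`. -/
def colSet (A : OmegaAut S Q (Set C)) (c : C) : Set (Q × S × Q) :=
  {t | ∃ h : t ∈ A.trans, c ∈ A.col ⟨t, h⟩}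

theorem colouredBy_colSet (A : OmegaAut S Q (Set C)) : A.ColouredBy A.colSet :=
  fun t _ => ⟨fun h => ⟨t.2, h⟩, fun ⟨_, h⟩ => h⟩

/-- The generalised Büchi automaton with the given initial state, transitions and colours. -/
def ofSets (q₀ : Q) (T : Set (Q × S × Q)) (F : C → Set (Q × S × Q)) : OmegaAut S Q (Set C) where
  init := q₀
  trans := T
  col t := {c | t.1 ∈ F c}
  acc := genBuchi C

theorem colouredBy_ofSets (q₀ : Q) (T : Set (Q × S × Q)) (F : C → Set (Q × S × Q)) :
    (ofSets q₀ T F).ColouredBy F := fun _ _ => Iff.rfl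

theorem isGenBuchi_ofSets (q₀ : Q) (T : Set (Q × S × Q)) (F : C → Set (Q × S × Q)) :
    (ofSets q₀ T F).IsGenBuchi := rfl

theorem isAccepting_iff [Finite C] {A : OmegaAut S Q (Set C)} (hA : A.IsGenBuchi)
    {F : C → Set (Q × S × Q)} (hF : A.ColouredBy F) (ρ : ℕ → A.trans) :
    A.IsAccepting ρ ↔ ∀ c, ∃ᶠ i in atTop, (ρ i).1 ∈ F c := by
  rw [IsAccepting, hA, mem_genBuchi_iff]
  simp only [hF _ _]

theorem lang_eq_recLang [Finite C] {A : OmegaAut S Q (Set C)} (hA : A.IsGenBuchi)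
    {F : C → Set (Q × S × Q)} (hF : A.ColouredBy F) : A.lang = recLang A.trans F A.init := by
  ext w
  constructor
  · rintro ⟨ρ, ⟨h0, hρ⟩, hacc⟩
    have he : ∀ i, (ρ i).1 = ((ρ i).1.1, w i, (ρ (i + 1)).1.1) := fun i =>
      Prod.ext rfl (Prod.ext (hρ i).1 (hρ i).2)
    refine ⟨fun i => (ρ i).1.1, h0, fun i => ?_, fun c => ?_⟩
    · rw [← he]
      exact (ρ i).2
    · simp only [← he]
      exact (isAccepting_iff hA hF ρ).1 hacc c
  · rintro ⟨r, h0, hr, hacc⟩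
    exact ⟨fun i => ⟨_, hr i⟩, ⟨h0, fun i => ⟨rfl, rfl⟩⟩, (isAccepting_iff hA hF _).2 hacc⟩

theorem isHD_iff_resolves [Finite C] {A : OmegaAut S Q (Set C)} (hA : A.IsGenBuchi)
    {F : C → Set (Q × S × Q)} (hF : A.ColouredBy F) :
    A.IsHD ↔ ∃ f, Resolves A.trans F A.init f := by
  classical
  constructor
  · rintro ⟨σ, hσ⟩
    let f : List S → Q := fun u => if h : u ≠ [] then (σ ⟨u, h⟩).1.2.2 else A.init
    have hf : ∀ w i, (A.inducedRun σ w i).1.2.2 = f (take w (i + 1)) := fun w i => by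
      have hne : take w (i + 1) ≠ [] := by simp [take]
      simp only [f, dif_pos hne]
      rfl
    have he : ∀ w i, (A.inducedRun σ w i).1 = (f (take w i), w i, f (take w (i + 1))) := by
      intro w i
      obtain ⟨⟨h0, hr⟩, -⟩ := hσ w
      refine Prod.ext ?_ (Prod.ext (hr i).1 (hf w i))
      cases i with
      | zero => rw [h0]; simp [f, take]
      | succ i => rw [← (hr i).2, hf]
    refine ⟨f, fun u a => ?_, by simp [f], fun w hw c => ?_⟩
    · have h1 := take_lapp u (scons a fun _ => a)
      have h2 : take (lapp u (scons a fun _ => a)) (u.length + 1) = u ++ [a] := by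
        rw [take_add, take_lapp, drop_lapp]
        rfl
      have h3 : lapp u (scons a fun _ => a) u.length = a := by
        rw [take_succ, h1] at h2
        simpa using h2
      have := he (lapp u (scons a fun _ => a)) u.length
      rw [h1, h2, h3] at this
      rw [← this]
      exact Subtype.prop _
    · rw [← lang_eq_recLang hA hF] at hw
      have := (isAccepting_iff hA hF _).1 ((hσ w).2 hw) c
      simpa only [he] using this
  · rintro ⟨f, hf, h0, hacc⟩
    have hmem : ∀ u : {u : List S // u ≠ []}, (f u.1.dropLast, u.1.getLast u.2, f u.1) ∈ A.trans :=
      fun u => by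
        have := hf u.1.dropLast (u.1.getLast u.2)
        rwa [List.dropLast_append_getLast u.2] at this
    have he : ∀ w i, (A.inducedRun (fun u => ⟨_, hmem u⟩) w i).1 =
        (f (take w i), w i, f (take w (i + 1))) := by
      intro w i
      have h1 : (pre w i).1 = take w i ++ [w i] := take_succ w i
      simp only [inducedRun, take_succ, h1, List.dropLast_concat, List.getLast_append_singleton]
    refine ⟨fun u => ⟨_, hmem u⟩, fun w => ⟨⟨?_, fun i => ?_⟩, fun hw => ?_⟩⟩
    · rw [he]
      exact h0
    · rw [he, he]
      exact ⟨rfl, rfl⟩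
    · rw [isAccepting_iff hA hF]
      simp only [he]
      exact hacc w (lang_eq_recLang hA hF ▸ hw)

theorem recLang_equiv {Q' C' : Type*} (e : Q' ≃ Q) (g : C' ≃ C) (T : Set (Q × S × Q))
    (F : C → Set (Q × S × Q)) (q : Q') :
    recLang {t : Q' × S × Q' | (e t.1, t.2.1, e t.2.2) ∈ T}
      (fun c : C' => {t : Q' × S × Q' | (e t.1, t.2.1, e t.2.2) ∈ F (g c)}) q =
    recLang T F (e q) := by
  ext w
  constructor
  · rintro ⟨r, rfl, hr, hF⟩
    refine ⟨fun i => e (r i), rfl, hr, fun c => ?_⟩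
    obtain ⟨c, rfl⟩ := g.surjective c
    exact hF c
  · rintro ⟨r, h0, hr, hF⟩
    refine ⟨fun i => e.symm (r i), by simp [h0], fun i => ?_, fun c => ?_⟩
    · simpa using hr i
    · simpa using hF (g c)

/-- Every finite automaton has an isomorphic copy on initial segments of `ℕ`. -/
theorem exists_fin_model [Finite Q] [Finite C] {A : OmegaAut S Q (Set C)} (hA : A.IsGenBuchi) :
    ∃ B : OmegaAut S (Fin (Nat.card Q)) (Set (Fin (Nat.card C))), B.IsGenBuchi ∧
      B.lang = A.lang ∧ (A.IsDet → B.IsDet) ∧ (A.IsHD → B.IsHD) := by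
  let e := (Finite.equivFin Q).symm
  let g := (Finite.equivFin C).symm
  let T := {t : Fin (Nat.card Q) × S × Fin (Nat.card Q) | (e t.1, t.2.1, e t.2.2) ∈ A.trans}
  let F : Fin (Nat.card C) → Set (Fin (Nat.card Q) × S × Fin (Nat.card Q)) :=
    fun c => {t | (e t.1, t.2.1, e t.2.2) ∈ A.colSet (g c)}
  have hL : recLang T F (e.symm A.init) = recLang A.trans A.colSet A.init := by
    rw [recLang_equiv, Equiv.apply_symm_apply]
  refine ⟨ofSets (e.symm A.init) T F, rfl, ?_, fun hdet p a q q' h h' => ?_, fun hHD => ?_⟩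
  · rw [lang_eq_recLang (isGenBuchi_ofSets _ _ _) (colouredBy_ofSets _ _ _), lang_eq_recLang hA A.colouredBy_colSet]
    exact hL
  · exact e.injective (hdet _ _ _ _ h h')
  · obtain ⟨f, hf, h0, hacc⟩ := (isHD_iff_resolves hA A.colouredBy_colSet).1 hHD
    refine (isHD_iff_resolves (isGenBuchi_ofSets _ _ _) (colouredBy_ofSets _ _ _)).2
      ⟨fun u => e.symm (f u), fun u a => ?_, congrArg e.symm h0, fun w hw c => ?_⟩
    · simpa [ofSets, T] using hf u a
    · have hw' : w ∈ recLang A.trans A.colSet A.init := hL ▸ hw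
      simpa [F] using hacc w hw' (g c)

/-! ### Minimal automata with few colours -/

/-- A minimal deterministic generalised Büchi automaton with few colours. -/
theorem exists_minimal_det [Finite Q] [Finite C] {A : OmegaAut S Q (Set C)} (hA : A.IsGenBuchi)
    (hdet : A.IsDet) :
    ∃ (m j : ℕ) (B : OmegaAut S (Fin m) (Set (Fin j))),
      B.lang = A.lang ∧ B.IsMinimalDetGenBuchi ∧ j ≤ Nat.card Q ^ 2 * Nat.card C := by
  classical
  let p : ℕ → Prop := fun m => ∃ (j : ℕ) (B : OmegaAut S (Fin m) (Set (Fin j))),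
    B.IsGenBuchi ∧ B.IsDet ∧ B.lang = A.lang
  have hp : p (Nat.card Q) := by
    obtain ⟨B, hB, hL, hD, -⟩ := exists_fin_model hA
    exact ⟨_, B, hB, hD hdet, hL⟩
  have hex : ∃ m, p m := ⟨_, hp⟩
  obtain ⟨j, B, hB, hBdet, hBL⟩ := Nat.find_spec hex
  have hle : Nat.find hex ≤ Nat.card Q := Nat.find_min' hex hp
  have hTL := recLang_trimmed (T := B.trans) (F := B.colSet) B.init
  have hAL : recLang A.trans A.colSet A.init = recLang B.trans B.colSet B.init := by
    rw [← lang_eq_recLang hA A.colouredBy_colSet, ← lang_eq_recLang hB B.colouredBy_colSet, hBL]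
  obtain ⟨J, hJ, hJL⟩ : ∃ J : Set (Fin j), Nat.card J ≤ Nat.find hex * Nat.card (Q × C) ∧
      recLang (trimmed B.trans B.colSet) (fun c : J => B.colSet c) B.init =
        recLang B.trans B.colSet B.init := by
    -- `A` may be incomplete and have no run on a rejected word. Trimming `B` leaves only words all
    -- of whose prefixes extend into the language, and on these `A` has a run.
    have := exists_few_colours (T := trimmed B.trans B.colSet) (F := B.colSet) (q₀ := B.init)
      (E := avoidGraph A.trans A.colSet) (fun w hw hwp => by
        rw [hTL, ← hAL] at hw ⊢
        refine exists_refutes_of_det hdet hw fun t => ?_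
        rw [hAL]
        exact exists_lapp_mem_of_trimmed hwp t)
    rwa [hTL, Nat.card_fin] at this
  have hB' : (ofSets B.init (trimmed B.trans B.colSet)
    (fun c : J => B.colSet c)).IsGenBuchi := rfl
  obtain ⟨D, hD, hDL, hDdet, -⟩ := exists_fin_model hB'
  rw [lang_eq_recLang hB' (colouredBy_ofSets _ _ _)] at hDL
  have hDA : D.lang = A.lang := by
    rw [hDL, lang_eq_recLang hA A.colouredBy_colSet, hAL]
    exact hJL
  refine ⟨_, _, D, hDA, ⟨hD, hDdet fun p a q q' h h' => hBdet p a q q' h.1 h'.1, ?_⟩, ?_⟩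
  · intro Q' C' _ _ B' hB' hdet' hL'
    obtain ⟨D', hD', hDL', hDdet', -⟩ := exists_fin_model hB'
    simp only [Nat.card_fin]
    exact Nat.find_min' hex ⟨_, D', hD', hDdet' hdet', hDL'.trans (hL'.trans hDA)⟩
  · refine hJ.trans ?_
    rw [Nat.card_prod, sq, mul_assoc]
    exact Nat.mul_le_mul_right _ hle

/-- A minimal history-deterministic generalised Büchi automaton with few colours. -/
theorem exists_minimal_HD [Finite S] [Finite Q] [Finite C] {A : OmegaAut S Q (Set C)}
    (hA : A.IsGenBuchi) (hHD : A.IsHD) :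
    ∃ (m j : ℕ) (B : OmegaAut S (Fin m) (Set (Fin j))),
      B.lang = A.lang ∧ B.IsMinimalHDGenBuchi ∧ j ≤ Nat.card Q ^ 2 * Nat.card C := by
  classical
  let p : ℕ → Prop := fun m => ∃ (j : ℕ) (B : OmegaAut S (Fin m) (Set (Fin j))),
    B.IsGenBuchi ∧ B.IsHD ∧ B.lang = A.lang
  have hp : p (Nat.card Q) := by
    obtain ⟨B, hB, hL, -, hD⟩ := exists_fin_model hA
    exact ⟨_, B, hB, hD hHD, hL⟩
  have hex : ∃ m, p m := ⟨_, hp⟩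
  obtain ⟨j, B, hB, hBHD, hBL⟩ := Nat.find_spec hex
  have hle : Nat.find hex ≤ Nat.card Q := Nat.find_min' hex hp
  have hAL : recLang A.trans A.colSet A.init = recLang B.trans B.colSet B.init := by
    rw [← lang_eq_recLang hA A.colouredBy_colSet, ← lang_eq_recLang hB B.colouredBy_colSet, hBL]
  obtain ⟨f, hf⟩ := (isHD_iff_resolves hA A.colouredBy_colSet).1 hHD
  obtain ⟨P, _, E, hP, hE⟩ := hf.exists_refutes
  rw [hAL] at hE
  obtain ⟨J, hJ, hJL⟩ := exists_few_colours (E := E) fun w hw _ => hE w hw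
  have hB' : (ofSets B.init B.trans (fun c : J => B.colSet c)).IsGenBuchi := rfl
  -- The language is unchanged and fewer colours are demanded, so the resolver of `B` still works.
  have hHD' : (ofSets B.init B.trans (fun c : J => B.colSet c)).IsHD := by
    obtain ⟨k, hk, h0, hacc⟩ := (isHD_iff_resolves hB B.colouredBy_colSet).1 hBHD
    exact (isHD_iff_resolves hB' (colouredBy_ofSets _ _ _)).2
      ⟨k, hk, h0, fun w hw c => hacc w (hJL ▸ hw) c⟩
  obtain ⟨D, hD, hDL, -, hDHD⟩ := exists_fin_model hB'
  rw [lang_eq_recLang hB' (colouredBy_ofSets _ _ _)] at hDL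
  have hDA : D.lang = A.lang := by
    rw [hDL, lang_eq_recLang hA A.colouredBy_colSet, hAL]
    exact hJL
  refine ⟨_, _, D, hDA, ⟨hD, hDHD hHD', ?_⟩, ?_⟩
  · intro Q' C' _ _ B' hB' hHD' hL'
    obtain ⟨D', hD', hDL', -, hDHD'⟩ := exists_fin_model hB'
    simp only [Nat.card_fin]
    exact Nat.find_min' hex ⟨_, D', hD', hDHD' hHD', hDL'.trans (hL'.trans hDA)⟩
  · refine hJ.trans ?_
    rw [Nat.card_fin, sq, mul_assoc]
    exact Nat.mul_le_mul hle hP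

end OmegaAut

theorem mainTheorem7 :
    (∃ K : ℕ, ∀ (S Q C : Type*) [Finite S] [Finite Q] [Finite C] (A : OmegaAut S Q (Set C)),
      A.IsGenBuchi → A.IsDet →
        ∃ (m j : ℕ) (B : OmegaAut S (Fin m) (Set (Fin j))),
          B.lang = A.lang ∧ B.IsMinimalDetGenBuchi ∧
            j ≤ K * (Nat.card Q ^ 2 * Nat.card C)) ∧
    (∃ K : ℕ, ∀ (S Q C : Type*) [Finite S] [Finite Q] [Finite C] (A : OmegaAut S Q (Set C)),
      A.IsGenBuchi → A.IsHD →
        ∃ (m j : ℕ) (B : OmegaAut S (Fin m) (Set (Fin j))),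
          B.lang = A.lang ∧ B.IsMinimalHDGenBuchi ∧
            j ≤ K * (Nat.card Q ^ 3 * Nat.card C ^ 2)) := by
  refine ⟨⟨1, fun S Q C _ _ _ A hA hdet => ?_⟩, ⟨1, fun S Q C _ _ _ A hA hHD => ?_⟩⟩
  · simpa only [one_mul] using OmegaAut.exists_minimal_det hA hdet
  · obtain ⟨m, j, B, hL, hmin, hj⟩ := OmegaAut.exists_minimal_HD hA hHD
    refine ⟨m, j, B, hL, hmin, hj.trans ?_⟩
    rw [one_mul]
    refine Nat.mul_le_mul ?_ (Nat.le_self_pow two_ne_zero _)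
    -- Passing from n² to n³ needs n > 0.
    have : Nonempty Q := ⟨A.init⟩
    exact Nat.pow_le_pow_right Nat.card_pos (by norm_num)
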